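/- Let $m\ge 0$ items be sold to a single additive buyer whose public budget is $b\ge 0$ and whose vector of values $t\in\mathbb{R}_{\ge 0}^m$ is drawn from a discrete distribution $V$ with probability mass function $f$ and (finite or countable) support $T$, and suppose that $V$ is independent across items, i.e. $V=V_1\times\dots\times V_m$. Define: - $\mathrm{Rev}^b(V)$, the supremum of the expected revenue $\sum_{t\in T} f(t)\,p(t)$ over all pairs $\pi:T\to[0,1]^m$, $p:T\to\mathbb{R}$ for which this expectation is finite and which satisfy, for all $t,t'\in T$, the constraints $\pi(t)^\top t-p(t)\ge \pi(t')^\top t-p(t')$ (incentive compatibility), $\pi(t)^\top t-p(t)\ge 0$ (individual rationality) and $p(t)\le b$ (budget). - $\mathrm{SRev}^b(V)$, the supremum of the expected revenue from posting item prices $q\in\mathbb{R}_{\ge0}^m$, where a buyer of type $t$ buys a set $S\subseteq[m]$ that maximizes $\sum_{j\in S}(t_j-q_j)$ among all sets with $\sum_{j\in S}q_j\le b$ (ties broken in favour of the seller) and pays $\sum_{j\in S}q_j$. - $\mathrm{BRev}^b(V)=\sup_{0\le q\le b}\, q\cdot\Pr_{t\sim V}\big[\sum_j t_j\ge q\big]$,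 the optimal revenue from posting a price for the bundle of all items. Then $$\mathrm{Rev}^b(V)\le 8\,\mathrm{SRev}^b(V)+24\,\mathrm{BRev}^b(V)\qquad\text{and, more sharply,}\qquad \mathrm{Rev}^b(V)\le 5\,\mathrm{SRev}^b(V)+6\,\mathrm{BRev}^b(V).$$ Consequently $\mathrm{Rev}^b(V)\le 11\,\max\big(\mathrm{SRev}^b(V),\mathrm{BRev}^b(V)\big)$: the better of selling items separately and selling the grand bundle is a constant-factor approximation to the optimal revenue. -/

import Mathlib

/-- The type (valuation profile) of an additive buyer for `m` items: `t j` is the value of item `j`. -/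
abbrev BuyerType (m : ℕ) := Fin m → ℝ

namespace BudgetAuction

/-- `V` is independent across items: it is the product of `m` one-dimensional distributions. -/
def IndependentAcrossItems {m : ℕ} (V : PMF (BuyerType m)) : Prop :=
  ∃ D : Fin m → PMF ℝ, ∀ t : BuyerType m, V t = ∏ j, D j (t j)

/-- `R` is the expectation of `pay t` for `t` drawn from `V`
(in particular, this expectation exists). -/
def IsExpectedRevenue {m : ℕ} (V : PMF (BuyerType m)) (pay : BuyerType m → ℝ) (R : ℝ) : Prop :=
  HasSum (fun t => (V t).toReal * pay t) R

/-- The direct mechanism with (interim) allocation rule `x` and payment rule `p` is feasible for a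
buyer with type distribution `V` and public budget `b`. Only reports in the support of `V` matter;
individual rationality is incentive compatibility towards not participating. -/
structure IsTruthful {m : ℕ} (b : ℝ) (V : PMF (BuyerType m))
    (x : BuyerType m → Fin m → ℝ) (p : BuyerType m → ℝ) : Prop where
  /-- allocations are probabilities -/
  alloc : ∀ t ∈ V.support, ∀ j, 0 ≤ x t j ∧ x t j ≤ 1
  /-- incentive compatibility -/
  ic : ∀ t ∈ V.support, ∀ t' ∈ V.support,
    ∑ j, x t' j * t j - p t' ≤ ∑ j, x t j * t j - p t
  /-- individual rationality -/
  ir : ∀ t ∈ V.support, 0 ≤ ∑ j, x t j * t j - p t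
  /-- budget constraint -/
  budget : ∀ t ∈ V.support, p t ≤ b

/-- The expected revenues of truthful mechanisms for a buyer with public budget `b`. -/
def truthfulRevenues {m : ℕ} (b : ℝ) (V : PMF (BuyerType m)) : Set ℝ :=
  {R | ∃ (x : BuyerType m → Fin m → ℝ) (p : BuyerType m → ℝ),
    IsTruthful b V x p ∧ IsExpectedRevenue V p R}

/-- Facing item prices `q`, a buyer of type `t` with budget `b` may choose to buy the set `S`:
he can afford `S`, and no affordable set gives him a larger utility. -/
def IsDemanded {m : ℕ} (b : ℝ) (q : Fin m → ℝ) (t : BuyerType m) (S : Finset (Fin m)) : Prop :=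
  ∑ j ∈ S, q j ≤ b ∧
    ∀ S' : Finset (Fin m), ∑ j ∈ S', q j ≤ b → ∑ j ∈ S', (t j - q j) ≤ ∑ j ∈ S, (t j - q j)

/-- The expected revenues of selling items separately at posted prices `q` to a buyer with public
budget `b`, where `S t` is a utility-maximizing affordable set for type `t`. In the supremum, ties
between optimal sets are thus resolved in favour of the seller. -/
def separateRevenues {m : ℕ} (b : ℝ) (V : PMF (BuyerType m)) : Set ℝ :=
  {R | ∃ (q : Fin m → ℝ) (S : BuyerType m → Finset (Fin m)),
    (∀ j, 0 ≤ q j) ∧ (∀ t ∈ V.support, IsDemanded b q t (S t)) ∧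
      IsExpectedRevenue V (fun t => ∑ j ∈ S t, q j) R}

open Classical in
/-- The payment of type `t` with budget `b` when the bundle of all items is offered at price `q`. -/
noncomputable def bundlePayment {m : ℕ} (b q : ℝ) (t : BuyerType m) : ℝ :=
  if q ≤ b ∧ q ≤ ∑ j, t j then q else 0

/-- The expected revenues of posting a price for the grand bundle, with public budget `b`. -/
def bundleRevenues {m : ℕ} (b : ℝ) (V : PMF (BuyerType m)) : Set ℝ :=
  {R | ∃ q : ℝ, 0 ≤ q ∧ IsExpectedRevenue V (bundlePayment b q) R}

/-- The optimal revenue of a truthful mechanism, with public budget `b`. -/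
noncomputable def Rev {m : ℕ} (b : ℝ) (V : PMF (BuyerType m)) : ℝ := sSup (truthfulRevenues b V)

/-- The optimal revenue of pricing each item separately, with public budget `b`. -/
noncomputable def SRev {m : ℕ} (b : ℝ) (V : PMF (BuyerType m)) : ℝ := sSup (separateRevenues b V)

/-- The optimal revenue of pricing the grand bundle, with public budget `b`. -/
noncomputable def BRev {m : ℕ} (b : ℝ) (V : PMF (BuyerType m)) : ℝ := sSup (bundleRevenues b V)

/-! The three suprema are over nonempty sets of reals that are bounded above by the budget. -/

theorem hasSum_prob {m : ℕ} (V : PMF (BuyerType m)) : HasSum (fun t => (V t).toReal) 1 := by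
  have h := (ENNReal.summable_toReal (f := fun t => V t) (by simp [V.tsum_coe])).hasSum
  rwa [← ENNReal.tsum_toReal_eq (fun t => V.apply_ne_top t), V.tsum_coe, ENNReal.toReal_one] at h

theorem IsExpectedRevenue.le {m : ℕ} {V : PMF (BuyerType m)} {pay : BuyerType m → ℝ} {R b : ℝ}
    (h : IsExpectedRevenue V pay R) (hp : ∀ t ∈ V.support, pay t ≤ b) : R ≤ b := by
  have h1 : HasSum (fun t => (V t).toReal * b) (1 * b) := (hasSum_prob V).mul_right b
  rw [one_mul] at h1
  refine hasSum_le (fun t => ?_) h h1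
  by_cases ht : t ∈ V.support
  · exact mul_le_mul_of_nonneg_left (hp t ht) ENNReal.toReal_nonneg
  · simp [(V.apply_eq_zero_iff t).2 ht]

theorem exists_isExpectedRevenue {m : ℕ} (V : PMF (BuyerType m)) (pay : BuyerType m → ℝ) (C : ℝ)
    (h0 : ∀ t, 0 ≤ pay t) (h1 : ∀ t, pay t ≤ C) : ∃ R, IsExpectedRevenue V pay R :=
  ⟨_, (Summable.of_nonneg_of_le (fun t => mul_nonneg ENNReal.toReal_nonneg (h0 t))
    (fun t => mul_le_mul_of_nonneg_left (h1 t) ENNReal.toReal_nonneg)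
    ((hasSum_prob V).mul_right C).summable).hasSum⟩

theorem truthfulRevenues_bddAbove {m : ℕ} (b : ℝ) (V : PMF (BuyerType m)) :
    BddAbove (truthfulRevenues b V) := by
  refine ⟨b, ?_⟩
  rintro R ⟨x, p, hM, hR⟩
  exact hR.le hM.budget

theorem separateRevenues_bddAbove {m : ℕ} (b : ℝ) (V : PMF (BuyerType m)) :
    BddAbove (separateRevenues b V) := by
  refine ⟨b, ?_⟩
  rintro R ⟨q, S, -, hS, hR⟩
  exact hR.le fun t ht => (hS t ht).1

theorem bundleRevenues_bddAbove {m : ℕ} {b : ℝ} (hb : 0 ≤ b) (V : PMF (BuyerType m)) :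
    BddAbove (bundleRevenues b V) := by
  refine ⟨b, ?_⟩
  rintro R ⟨q, -, hR⟩
  refine hR.le fun t _ => ?_
  unfold bundlePayment
  split_ifs with h
  · exact h.1
  · exact hb

theorem truthfulRevenues_nonempty {m : ℕ} {b : ℝ} (hb : 0 ≤ b) (V : PMF (BuyerType m)) :
    (truthfulRevenues b V).Nonempty :=
  ⟨0, 0, 0, ⟨by simp, by simp, by simp, by simpa using fun _ _ => hb⟩,
    by simpa [IsExpectedRevenue] using hasSum_zero⟩

/-- At every nonnegative price vector the seller has a well-defined revenue. -/
theorem exists_separateRevenue {m : ℕ} {b : ℝ} (hb : 0 ≤ b) (V : PMF (BuyerType m))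
    (q : Fin m → ℝ) (hq : ∀ j, 0 ≤ q j) :
    ∃ (S : BuyerType m → Finset (Fin m)) (R : ℝ), (∀ t, IsDemanded b q t (S t)) ∧
      IsExpectedRevenue V (fun t => ∑ j ∈ S t, q j) R := by
  classical
  have key : ∀ t : BuyerType m, ∃ S, IsDemanded b q t S := fun t => by
    obtain ⟨S, hS, hmax⟩ := Finset.exists_max_image
      (Finset.univ.filter fun S : Finset (Fin m) => ∑ j ∈ S, q j ≤ b)
      (fun S => ∑ j ∈ S, (t j - q j)) ⟨∅, by simpa using hb⟩
    exact ⟨S, by simpa using hS, fun S' hS' => hmax S' (by simpa using hS')⟩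
  choose S hS using key
  obtain ⟨R, hR⟩ := exists_isExpectedRevenue V (fun t => ∑ j ∈ S t, q j) b
    (fun t => Finset.sum_nonneg fun j _ => hq j) (fun t => (hS t).1)
  exact ⟨S, R, hS, hR⟩

theorem separateRevenues_nonempty {m : ℕ} {b : ℝ} (hb : 0 ≤ b) (V : PMF (BuyerType m)) :
    (separateRevenues b V).Nonempty := by
  obtain ⟨S, R, hS, hR⟩ := exists_separateRevenue hb V 0 (fun _ => le_rfl)
  exact ⟨R, 0, S, fun _ => le_rfl, fun t _ => hS t, hR⟩

theorem bundleRevenues_nonempty {m : ℕ} (b : ℝ) (V : PMF (BuyerType m)) :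
    (bundleRevenues b V).Nonempty :=
  ⟨0, 0, le_rfl, by simpa [IsExpectedRevenue, bundlePayment] using hasSum_zero⟩

end BudgetAuction

/-!
The trivial bound `Rev ≤ b` reduces the claim to the case `5 * SRev + 6 * BRev < b`. Then the bundle
prices `q ≤ b` show that the total value of the buyer is rarely large: it is at least `b / 2` with
probability at most `2 * BRev / b`. So the budget seldom matters, and the values can be compared
with `R`, the sum of the optimal revenues `itemRevenue` from the single items at prices up to `b / 2`.

Upper bound (`integral_payment_le`). If some item is worth `b / 2` or more, the payment is at most
`b`, which costs `2 * BRev` in expectation. Otherwise the payment is split at the favorite item.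
* What is paid in excess of the value of the other items is, for fixed values of those, the payment
  of a truthful mechanism for the favorite item alone, and such a mechanism earns no more than a
  posted price (`IsSingleItemMechanism.integral_le`); in total this is at most `R`.
* The other items worth more than `R` contribute at most `R`: item `j` at value `t` is not the
  favorite only if another item has a value of at least `t`, and a price of `t` earns at most `R`
  from all items together (`integral_tail_sum_le`).
* The items worth at most `R` have a total value of variance at most `2 * R ^ 2`, so Chebyshev's
  inequality bounds its mean by `2 * R + 2 * BRev` (`integral_core_le`).

Together, `Rev ≤ 4 * R + 4 * BRev`.

Lower bound (`posted_le_SRev`). At item prices up to `b / 2`, an item is bought whenever it is worth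
its price and the other items are worth less than `b / 2`. These two events are independent, so
`(1 - π) * R ≤ SRev` where `π ≤ 2 * BRev / b` is the probability of a total value of at least
`b / 2`. As `5 * SRev + 6 * BRev < b`, this implies `4 * R ≤ 5 * SRev + 2 * BRev`.

The values are modelled on the product of the countable supports of the item distributions, where
every function is measurable and the types of probability zero are absent.
-/

open MeasureTheory ProbabilityTheory

namespace BudgetAuction

/-! ### Single-item mechanisms -/

/-- `x` and `p` are the allocation and payment rules of an incentive compatible and individually
rational mechanism for one item, for a buyer whose possible values are the elements of `E`. -/
structure IsSingleItemMechanism {A : Set ℝ} (E : Set A) (x p : A → ℝ) : Prop where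
  nonneg : ∀ a ∈ E, 0 ≤ x a
  le_one : ∀ a ∈ E, x a ≤ 1
  ic : ∀ a ∈ E, ∀ a' ∈ E, p a - p a' ≤ a * (x a - x a')
  ir : ∀ a ∈ E, p a ≤ a * x a

theorem IsSingleItemMechanism.mono {A : Set ℝ} {E : Set A} {x p : A → ℝ}
    (h : IsSingleItemMechanism E x p) {a a' : A} (ha : a ∈ E) (ha' : a' ∈ E)
    (hlt : (a : ℝ) < a') : x a ≤ x a' := by
  by_contra hcon
  have h1 := h.ic a ha a' ha'
  have h2 := h.ic a' ha' a ha
  nlinarith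

/-- Each increment `x a - x a'` of the allocation between consecutive values costs at most `a` to
every value above `a`, hence yields at most `r * (x a - x a')` in expectation. The values in `s` are
treated from the smallest one upwards; `X` and `P` are the allocation and payment at the value
preceding `s`. -/
theorem IsSingleItemMechanism.sum_le {A : Set ℝ} [Countable A] {μ : Measure A}
    [IsProbabilityMeasure μ] {E : Set A} {x p : A → ℝ} (h : IsSingleItemMechanism E x p) {r : ℝ}
    (hr0 : 0 ≤ r) (hA : ∀ a ∈ A, 0 ≤ a) (hr : ∀ a ∈ E, a * μ.real {a' | (a : ℝ) ≤ a'} ≤ r)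
    (s : Finset A) (hs : ∀ a ∈ s, a ∈ E) (X P : ℝ) (hX1 : X ≤ 1) (hX : ∀ a ∈ s, X ≤ x a)
    (hP : ∀ a ∈ s, p a - P ≤ a * (x a - X)) :
    ∑ a ∈ s, μ.real {a} * (p a - P) ≤ r * (1 - X) := by
  classical
  induction s using Finset.induction_on_min generalizing X P with
  | empty => simpa using mul_nonneg hr0 (by linarith)
  | insert a s hlt ih =>
    have haE : a ∈ E := hs a (by simp)
    have hsE : ∀ a' ∈ s, a' ∈ E := fun a' h' => hs a' (by simp [h'])
    have h1 : ∑ a' ∈ insert a s, μ.real {a'} * (p a' - P)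
        = (∑ a' ∈ insert a s, μ.real {a'}) * (p a - P)
          + ∑ a' ∈ s, μ.real {a'} * (p a' - p a) := by
      have ha : a ∉ s := fun hmem => lt_irrefl _ (hlt a hmem)
      rw [Finset.sum_insert ha, Finset.sum_insert ha, add_mul, Finset.sum_mul, add_assoc,
        ← Finset.sum_add_distrib]
      congr 1
      exact Finset.sum_congr rfl fun a' _ => by ring
    have h2 : ∑ a' ∈ s, μ.real {a'} * (p a' - p a) ≤ r * (1 - x a) :=
      ih hsE (x a) (p a) (h.le_one a haE) (fun a' h' => h.mono haE (hsE a' h') (hlt a' h'))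
        (fun a' h' => h.ic a' (hsE a' h') a haE)
    have h3 : ∑ a' ∈ insert a s, μ.real {a'} ≤ μ.real {a' | (a : ℝ) ≤ a'} := by
      rw [sum_measureReal_singleton]
      refine measureReal_mono fun a' ha' => ?_
      rcases Finset.mem_insert.1 (Finset.mem_coe.1 ha') with rfl | h'
      · exact le_refl (_ : ℝ)
      · exact (hlt a' h').le
    have h4 : 0 ≤ ∑ a' ∈ insert a s, μ.real {a'} :=
      Finset.sum_nonneg fun _ _ => measureReal_nonneg
    have h5 : (∑ a' ∈ insert a s, μ.real {a'}) * (p a - P) ≤ r * (x a - X) := by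
      have h6 := mul_le_mul_of_nonneg_left (hP a (by simp)) h4
      have h7 : a * ∑ a' ∈ insert a s, μ.real {a'} ≤ r :=
        (mul_le_mul_of_nonneg_left h3 (hA _ a.2)).trans (hr a haE)
      have h8 := mul_le_mul_of_nonneg_right h7 (sub_nonneg.2 (hX a (by simp)))
      linarith
    rw [h1]
    linarith

/-- A single-item mechanism earns no more, from the values in `E`, than the best posted price.
No integrability is needed, since the Bochner integral is `0` otherwise. -/
theorem IsSingleItemMechanism.integral_le {A : Set ℝ} [Countable A] {μ : Measure A}
    [IsProbabilityMeasure μ] {E : Set A} {x p : A → ℝ} (h : IsSingleItemMechanism E x p) {r : ℝ}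
    (hr0 : 0 ≤ r) (hA : ∀ a ∈ A, 0 ≤ a) (hr : ∀ a ∈ E, a * μ.real {a' | (a : ℝ) ≤ a'} ≤ r) :
    ∫ a, E.indicator p a ∂μ ≤ r := by
  classical
  by_cases hint : Integrable (E.indicator p) μ
  · have hsum : HasSum (fun a => μ.real {a} * E.indicator p a) (∫ a, E.indicator p a ∂μ) := by
      have h1 : Integrable (E.indicator p) (Measure.sum fun a => μ {a} • Measure.dirac a) := by
        rwa [Measure.sum_smul_dirac]
      have h2 := hasSum_integral_measure h1
      rw [Measure.sum_smul_dirac] at h2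
      simpa [integral_smul_measure, integral_dirac, Measure.real] using h2
    refine hasSum_le_of_sum_le hsum fun s => ?_
    have h3 := h.sum_le (μ := μ) hr0 hA hr (s.filter (· ∈ E)) (by simp) 0 0 zero_le_one
      (fun a ha => h.nonneg a (by simpa using (Finset.mem_filter.1 ha).2))
      (fun a ha => by simpa using h.ir a (by simpa using (Finset.mem_filter.1 ha).2))
    simp only [sub_zero, mul_one] at h3
    refine le_trans (le_of_eq ?_) h3
    rw [Finset.sum_filter]
    exact Finset.sum_congr rfl fun a _ => by by_cases ha : a ∈ E <;> simp [ha]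
  · rwa [integral_undef hint]

/-- The largest revenue from selling an item of value distribution `μ` at a price of at most `c`. -/
noncomputable def itemRevenue {A : Set ℝ} (c : ℝ) (μ : Measure A) : ℝ :=
  sSup ((fun q : ℝ => q * μ.real {a : A | q ≤ (a : ℝ)}) '' Set.Icc 0 c)

theorem itemRevenue_bddAbove {A : Set ℝ} (c : ℝ) (μ : Measure A) [IsProbabilityMeasure μ] :
    BddAbove ((fun q : ℝ => q * μ.real {a : A | q ≤ (a : ℝ)}) '' Set.Icc 0 c) := by
  refine ⟨c, ?_⟩
  rintro _ ⟨q, hq, rfl⟩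
  exact (mul_le_of_le_one_right hq.1 measureReal_le_one).trans hq.2

theorem le_itemRevenue {A : Set ℝ} {c q : ℝ} (μ : Measure A) [IsProbabilityMeasure μ]
    (h0 : 0 ≤ q) (hc : q ≤ c) : q * μ.real {a : A | q ≤ (a : ℝ)} ≤ itemRevenue c μ :=
  le_csSup (itemRevenue_bddAbove c μ) ⟨q, ⟨h0, hc⟩, rfl⟩

theorem itemRevenue_nonneg {A : Set ℝ} {c : ℝ} (hc : 0 ≤ c) (μ : Measure A)
    [IsProbabilityMeasure μ] : 0 ≤ itemRevenue c μ := by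
  simpa using le_itemRevenue μ le_rfl hc

theorem exists_price_near_itemRevenue {A : Set ℝ} {c ε : ℝ} (hc : 0 ≤ c) (μ : Measure A)
    (hε : 0 < ε) :
    ∃ q, 0 ≤ q ∧ q ≤ c ∧ itemRevenue c μ - ε ≤ q * μ.real {a : A | q ≤ (a : ℝ)} := by
  obtain ⟨_, ⟨q, hq, rfl⟩, h⟩ := exists_lt_of_lt_csSup
    (s := (fun q : ℝ => q * μ.real {a : A | q ≤ (a : ℝ)}) '' Set.Icc 0 c)
    ⟨_, 0, ⟨le_rfl, hc⟩, rfl⟩ (sub_lt_self (itemRevenue c μ) hε)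
  exact ⟨q, hq.1, hq.2, h.le⟩

/-- The truncated second moment of a value is controlled by the item revenue: `a ^ 2 / (2 * τ)` is
the payment of the truthful mechanism that allocates with probability `a / τ`. -/
theorem integral_sq_le {A : Set ℝ} [Countable A] (μ : Measure A) [IsProbabilityMeasure μ]
    {c τ : ℝ} (hc : 0 ≤ c) (hτ : 0 ≤ τ) (hA : ∀ a ∈ A, 0 ≤ a) :
    ∫ a : A, (if (a : ℝ) ≤ τ ∧ (a : ℝ) < c then (a : ℝ) else 0) ^ 2 ∂μ
      ≤ 2 * τ * itemRevenue c μ := by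
  rcases hτ.eq_or_lt with rfl | hτ
  · have : ∀ a : A, (if (a : ℝ) ≤ 0 ∧ (a : ℝ) < c then (a : ℝ) else 0) = 0 := fun a => by
      split_ifs with h
      · exact le_antisymm h.1 (hA a a.2)
      · rfl
    simp [this]
  have hM : IsSingleItemMechanism {a : A | (a : ℝ) ≤ τ ∧ (a : ℝ) < c} (fun a => (a : ℝ) / τ)
      (fun a => (a : ℝ) ^ 2 / (2 * τ)) := by
    refine ⟨fun a _ => div_nonneg (hA a a.2) hτ.le, fun a ha => (div_le_one hτ).2 ha.1,
      fun a _ a' _ => ?_, fun a _ => ?_⟩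
    · have h1 : (a : ℝ) * (a / τ - a' / τ) - ((a : ℝ) ^ 2 / (2 * τ) - (a' : ℝ) ^ 2 / (2 * τ))
          = ((a : ℝ) - a') ^ 2 / (2 * τ) := by
        field_simp
        ring
      have h2 : 0 ≤ ((a : ℝ) - a') ^ 2 / (2 * τ) := by positivity
      linarith
    · have h1 : (a : ℝ) * (a / τ) - (a : ℝ) ^ 2 / (2 * τ) = (a : ℝ) ^ 2 / (2 * τ) := by
        field_simp
        ring
      have h2 : 0 ≤ (a : ℝ) ^ 2 / (2 * τ) := by positivity
      linarith
  have h := hM.integral_le (μ := μ) (itemRevenue_nonneg hc μ) hA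
    fun a ha => le_itemRevenue μ (hA a a.2) ha.2.le
  have h1 : ∀ a : A, (if (a : ℝ) ≤ τ ∧ (a : ℝ) < c then (a : ℝ) else 0) ^ 2
      = 2 * τ * {a : A | (a : ℝ) ≤ τ ∧ (a : ℝ) < c}.indicator
          (fun a => (a : ℝ) ^ 2 / (2 * τ)) a := fun a => by
    by_cases ha : (a : ℝ) ≤ τ ∧ (a : ℝ) < c
    · rw [if_pos ha, Set.indicator_of_mem (by exact ha)]
      field_simp
    · rw [if_neg ha, Set.indicator_of_notMem (by exact ha)]
      simp
  simp_rw [h1]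
  rw [integral_const_mul]
  exact mul_le_mul_of_nonneg_left h (by positivity)

/-! ### Resampling one coordinate of a product distribution -/

theorem measurePreserving_update {ι : Type*} [Fintype ι] [DecidableEq ι] {α : ι → Type*}
    [∀ i, MeasurableSpace (α i)] (μ : ∀ i, Measure (α i)) [∀ i, IsProbabilityMeasure (μ i)]
    (j : ι) :
    MeasurePreserving (fun z : (∀ i, α i) × α j => Function.update z.1 j z.2)
      ((Measure.pi μ).prod (μ j)) (Measure.pi μ) := by
  have hmeas : Measurable fun z : (∀ i, α i) × α j => Function.update z.1 j z.2 := by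
    refine measurable_pi_lambda _ fun i => ?_
    by_cases hi : i = j
    · subst hi
      simpa using measurable_snd
    · simp only [Function.update_of_ne hi]
      exact (measurable_pi_apply i).comp measurable_fst
  refine ⟨hmeas, (Measure.pi_eq fun s hs => ?_).symm⟩
  have hpre : (fun z : (∀ i, α i) × α j => Function.update z.1 j z.2) ⁻¹' Set.univ.pi s
      = (Set.univ.pi (Function.update s j Set.univ)) ×ˢ s j := by
    ext ⟨ω, a⟩
    simp only [Set.mem_preimage, Set.mem_pi, Set.mem_univ, true_imp_iff, Set.mem_prod]
    constructor
    · intro h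
      refine ⟨fun i => ?_, by simpa using h j⟩
      by_cases hi : i = j
      · subst hi
        simp
      · simpa [hi] using h i
    · rintro ⟨h1, h2⟩ i
      by_cases hi : i = j
      · subst hi
        simpa using h2
      · simpa [hi] using h1 i
  rw [Measure.map_apply hmeas (MeasurableSet.univ_pi hs), hpre, Measure.prod_prod, Measure.pi_pi,
    ← Finset.prod_erase_mul _ _ (Finset.mem_univ j),
    ← Finset.prod_erase_mul _ (fun i => μ i (s i)) (Finset.mem_univ j)]
  simp only [Function.update_self, measure_univ, mul_one]
  congr 1
  exact Finset.prod_congr rfl fun i hi => by rw [Function.update_of_ne (Finset.ne_of_mem_erase hi)]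

theorem integral_update {ι : Type*} [Fintype ι] [DecidableEq ι] {α : ι → Type*}
    [∀ i, MeasurableSpace (α i)] (μ : ∀ i, Measure (α i)) [∀ i, IsProbabilityMeasure (μ i)]
    (j : ι) {g : (∀ i, α i) → ℝ} (hg : Integrable g (Measure.pi μ)) :
    ∫ ω, g ω ∂Measure.pi μ = ∫ ω, ∫ a, g (Function.update ω j a) ∂μ j ∂Measure.pi μ := by
  have h := measurePreserving_update μ j
  have h1 := h.integrable_comp_of_integrable hg
  rw [← h.map_eq, integral_map h.aemeasurable (by rw [h.map_eq]; exact hg.aestronglyMeasurable)]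
  conv_rhs => rw [h.map_eq]
  exact integral_prod _ h1

/-- An integral is bounded by that of `h` if this is so after averaging over the coordinate `j`. -/
theorem integral_le_of_forall_update {ι : Type*} [Fintype ι] [DecidableEq ι] {α : ι → Type*}
    [∀ i, MeasurableSpace (α i)] (μ : ∀ i, Measure (α i)) [∀ i, IsProbabilityMeasure (μ i)]
    (j : ι) {g h : (∀ i, α i) → ℝ} (hg : Integrable g (Measure.pi μ))
    (hh : Integrable h (Measure.pi μ)) (hle : ∀ ω, ∫ a, g (Function.update ω j a) ∂μ j ≤ h ω) :
    ∫ ω, g ω ∂Measure.pi μ ≤ ∫ ω, h ω ∂Measure.pi μ := by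
  rw [integral_update μ j hg]
  have h1 := (measurePreserving_update μ j).integrable_comp_of_integrable hg
  exact integral_mono h1.integral_prod_left hh hle

theorem integrable_of_abs_le {Ω : Type*} [MeasurableSpace Ω] [DiscreteMeasurableSpace Ω]
    [Countable Ω] {P : Measure Ω} [IsFiniteMeasure P] {f : Ω → ℝ} {C : ℝ} (h : ∀ ω, |f ω| ≤ C) :
    Integrable f P :=
  Integrable.of_bound StronglyMeasurable.of_discrete.aestronglyMeasurable C
    (Filter.Eventually.of_forall h)

/-! ### The favorite item -/

/-- For fixed values of the other items, what the buyer pays in excess of his value for the other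
items is the payment of a truthful mechanism for item `j`. This bounds its expectation over any
event `E` on which the value of item `j` is below `c`. -/
theorem integral_excessPayment_le {m : ℕ} {A : Fin m → Set ℝ} [∀ j, Countable (A j)]
    (μ : ∀ j, Measure (A j)) [∀ j, IsProbabilityMeasure (μ j)] (hA : ∀ j, ∀ a ∈ A j, 0 ≤ a)
    {c : ℝ} (hc : 0 ≤ c) {x : (∀ j, A j) → Fin m → ℝ} {p : (∀ j, A j) → ℝ}
    (hx : ∀ ω j, 0 ≤ x ω j ∧ x ω j ≤ 1)
    (hic : ∀ ω ω', ∑ j, x ω' j * (ω j : ℝ) - p ω' ≤ ∑ j, x ω j * (ω j : ℝ) - p ω)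
    (hir : ∀ ω, 0 ≤ ∑ j, x ω j * (ω j : ℝ) - p ω) (j : Fin m) (E : Set (∀ j, A j))
    (hE : ∀ ω ∈ E, (ω j : ℝ) < c)
    (hint : Integrable
      (E.indicator fun ω => p ω - ∑ k ∈ Finset.univ.erase j, x ω k * (ω k : ℝ)) (Measure.pi μ)) :
    ∫ ω, E.indicator (fun ω => p ω - ∑ k ∈ Finset.univ.erase j, x ω k * (ω k : ℝ)) ω
      ∂Measure.pi μ ≤ itemRevenue c (μ j) := by
  have h := integral_le_of_forall_update μ j hint (integrable_const (itemRevenue c (μ j))) ?_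
  · simpa using h
  intro ω
  have hother : ∀ (a a' : A j) (y : Fin m → ℝ),
      ∑ k ∈ Finset.univ.erase j, y k * (Function.update ω j a k : ℝ)
        = ∑ k ∈ Finset.univ.erase j, y k * (Function.update ω j a' k : ℝ) := fun a a' y =>
    Finset.sum_congr rfl fun k hk => by
      rw [Function.update_of_ne (Finset.ne_of_mem_erase hk),
        Function.update_of_ne (Finset.ne_of_mem_erase hk)]
  have hM : IsSingleItemMechanism {a : A j | Function.update ω j a ∈ E}
      (fun a => x (Function.update ω j a) j)
      (fun a => p (Function.update ω j a)
        - ∑ k ∈ Finset.univ.erase j, x (Function.update ω j a) k * (Function.update ω j a k : ℝ)) := by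
    refine ⟨fun a _ => (hx _ j).1, fun a _ => (hx _ j).2, fun a _ a' _ => ?_, fun a _ => ?_⟩
    · have h1 := hic (Function.update ω j a) (Function.update ω j a')
      rw [← Finset.add_sum_erase _ _ (Finset.mem_univ j),
        ← Finset.add_sum_erase _ (fun k => x (Function.update ω j a) k * _) (Finset.mem_univ j),
        hother a a' (x (Function.update ω j a'))] at h1
      simp only [Function.update_self] at h1
      linarith
    · have h1 := hir (Function.update ω j a)
      rw [← Finset.add_sum_erase _ _ (Finset.mem_univ j)] at h1
      simp only [Function.update_self] at h1
      linarith
  refine le_trans (le_of_eq ?_) (hM.integral_le (μ := μ j) (itemRevenue_nonneg hc (μ j)) (hA j)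
    fun a ha => le_itemRevenue (μ j) (hA j a a.2) ?_)
  · rfl
  · simpa using (hE _ ha).le

/-! ### Tail: expensive items that are not the favorite -/

/-- For a fixed value `t` of item `j`, posting the price `t` for item `k` earns `t` times the
probability that item `k` is at least as valuable as item `j`. -/
theorem integral_tail_le {m : ℕ} {A : Fin m → Set ℝ} [∀ j, Countable (A j)]
    (μ : ∀ j, Measure (A j)) [∀ j, IsProbabilityMeasure (μ j)] (hA : ∀ j, ∀ a ∈ A j, 0 ≤ a)
    {c τ : ℝ} (hc : 0 ≤ c) {j k : Fin m} (hjk : j ≠ k) :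
    ∫ ω : ∀ j, A j, (if (τ < ω j ∧ (ω j : ℝ) < c) ∧ (ω j : ℝ) ≤ ω k then (ω j : ℝ) else 0)
      ∂Measure.pi μ ≤ itemRevenue c (μ k) * (μ j).real {a | τ < a ∧ (a : ℝ) < c} := by
  have hmarg : ∫ ω : ∀ j, A j, {ω : ∀ j, A j | τ < ω j ∧ (ω j : ℝ) < c}.indicator
      (fun _ => itemRevenue c (μ k)) ω ∂Measure.pi μ
        = itemRevenue c (μ k) * (μ j).real {a | τ < a ∧ (a : ℝ) < c} := by
    rw [integral_indicator_const _ .of_discrete, smul_eq_mul, mul_comm]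
    congr 1
    exact (measurePreserving_eval μ j).measureReal_preimage
      (s := {a | τ < a ∧ (a : ℝ) < c}) (MeasurableSet.of_discrete.nullMeasurableSet)
  rw [← hmarg]
  refine integral_le_of_forall_update μ k (integrable_of_abs_le (C := c) fun ω => ?_)
    ((integrable_const _).indicator .of_discrete) fun ω => ?_
  · split_ifs with h
    · rw [abs_of_nonneg (hA j _ (ω j).2)]
      exact h.1.2.le
    · simpa using hc
  · simp only [Function.update_of_ne hjk, Function.update_self]
    by_cases h : τ < ω j ∧ (ω j : ℝ) < c
    · rw [Set.indicator_of_mem (by exact h)]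
      have h1 : ∀ a : A k, (if (τ < ω j ∧ (ω j : ℝ) < c) ∧ (ω j : ℝ) ≤ a then (ω j : ℝ) else 0)
          = {a : A k | (ω j : ℝ) ≤ a}.indicator (fun _ => (ω j : ℝ)) a := fun a => by
        by_cases ha : (ω j : ℝ) ≤ a <;> simp [h, ha]
      simp_rw [h1]
      rw [integral_indicator_const _ .of_discrete, smul_eq_mul, mul_comm]
      exact le_itemRevenue (μ k) (hA j _ (ω j).2) h.2.le
    · simp [h]

/-- With the total item revenue as threshold, the tail contributes at most that revenue. -/
theorem integral_tail_sum_le {m : ℕ} {A : Fin m → Set ℝ} [∀ j, Countable (A j)]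
    (μ : ∀ j, Measure (A j)) [∀ j, IsProbabilityMeasure (μ j)] (hA : ∀ j, ∀ a ∈ A j, 0 ≤ a)
    {c R : ℝ} (hc : 0 ≤ c) (hR : R = ∑ j, itemRevenue c (μ j)) :
    ∑ j, ∑ k ∈ Finset.univ.erase j,
      ∫ ω : ∀ j, A j, (if (R < ω j ∧ (ω j : ℝ) < c) ∧ (ω j : ℝ) ≤ ω k then (ω j : ℝ) else 0)
        ∂Measure.pi μ ≤ R := by
  have hR0 : 0 ≤ R := hR ▸ Finset.sum_nonneg fun j _ => itemRevenue_nonneg hc (μ j)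
  calc _ ≤ ∑ j, ∑ k ∈ Finset.univ.erase j,
          itemRevenue c (μ k) * (μ j).real {a | R < a ∧ (a : ℝ) < c} :=
        Finset.sum_le_sum fun j _ => Finset.sum_le_sum fun k hk =>
          integral_tail_le μ hA hc (Finset.ne_of_mem_erase hk).symm
    _ ≤ ∑ j, itemRevenue c (μ j) := by
        refine Finset.sum_le_sum fun j _ => ?_
        rw [← Finset.sum_mul]
        have h1 : ∑ k ∈ Finset.univ.erase j, itemRevenue c (μ k) ≤ R := by
          rw [hR]
          exact Finset.sum_le_sum_of_subset_of_nonneg (Finset.erase_subset _ _)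
            fun k _ _ => itemRevenue_nonneg hc (μ k)
        refine (mul_le_mul_of_nonneg_right h1 measureReal_nonneg).trans ?_
        rcases le_or_gt R c with hRc | hRc
        · refine le_trans (mul_le_mul_of_nonneg_left ?_ hR0) (le_itemRevenue (μ j) hR0 hRc)
          exact measureReal_mono fun a ha => ha.1.le
        · have h2 : {a : A j | R < a ∧ (a : ℝ) < c} = ∅ := by
            ext a
            simpa using fun h => (hRc.trans h).le
          rw [h2]
          simpa using itemRevenue_nonneg hc (μ j)
    _ = R := hR.symm

/-! ### Core: the total value of the cheap items -/

/-- The value of an item, cut off to `0` unless it is at most `τ` and less than `c`. -/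
noncomputable def coreValue (c τ v : ℝ) : ℝ := if v ≤ τ ∧ v < c then v else 0

theorem coreValue_nonneg {c τ v : ℝ} (hv : 0 ≤ v) : 0 ≤ coreValue c τ v := by
  unfold coreValue
  split_ifs <;> simp [hv]

theorem coreValue_le_self {c τ v : ℝ} (hv : 0 ≤ v) : coreValue c τ v ≤ v := by
  unfold coreValue
  split_ifs <;> simp [hv]

theorem abs_coreValue_le {c τ v : ℝ} (hc : 0 ≤ c) (hv : 0 ≤ v) : |coreValue c τ v| ≤ c := by
  rw [abs_of_nonneg (coreValue_nonneg hv)]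
  unfold coreValue
  split_ifs with h
  exacts [h.2.le, hc]

/-- The core is a sum of independent values of total variance at most `2 * R ^ 2`, so by Chebyshev's
inequality it exceeds its mean minus `2 * R` with probability at least one half. Hence its mean
minus `2 * R` is a good bundle price, unless it exceeds the budget; but in that case the budget
itself would be a bundle price of revenue at least `b / 2`, contrary to `2 * B < b`. -/
theorem integral_core_le {m : ℕ} {A : Fin m → Set ℝ} [∀ j, Countable (A j)]
    (μ : ∀ j, Measure (A j)) [∀ j, IsProbabilityMeasure (μ j)] (hA : ∀ j, ∀ a ∈ A j, 0 ≤ a)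
    {b c R B : ℝ} (hc : 0 ≤ c) (hR : R = ∑ j, itemRevenue c (μ j)) (hB0 : 0 ≤ B)
    (hBb : 2 * B < b)
    (hB : ∀ q, 0 ≤ q → q ≤ b → q * (Measure.pi μ).real {ω | q ≤ ∑ j, (ω j : ℝ)} ≤ B) :
    ∑ j, ∫ ω : ∀ j, A j, coreValue c R (ω j) ∂Measure.pi μ ≤ 2 * R + 2 * B := by
  have hR0 : 0 ≤ R := hR ▸ Finset.sum_nonneg fun j _ => itemRevenue_nonneg hc (μ j)
  rcases hR0.eq_or_lt with h0 | hRpos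
  · have h1 : ∀ (j : Fin m) (ω : ∀ j, A j), coreValue c R (ω j) = 0 := fun j ω => by
      unfold coreValue
      split_ifs with h
      · exact le_antisymm (h0 ▸ h.1) (hA j _ (ω j).2)
      · rfl
    simp only [h1, integral_zero, Finset.sum_const_zero]
    linarith
  set P := Measure.pi μ
  set Y : Fin m → (∀ j, A j) → ℝ := fun j ω => coreValue c R (ω j) with hY
  have hYabs : ∀ j ω, |Y j ω| ≤ c := fun j ω => abs_coreValue_le hc (hA j _ (ω j).2)
  have hYint : ∀ j, Integrable (Y j) P := fun j => integrable_of_abs_le (hYabs j)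
  have hYmem : ∀ j, MemLp (Y j) 2 P := fun j =>
    MemLp.of_bound StronglyMeasurable.of_discrete.aestronglyMeasurable c
      (Filter.Eventually.of_forall (hYabs j))
  have hind : iIndepFun Y P :=
    iIndepFun_pi (X := fun j (a : A j) => coreValue c R a)
      fun j => Measurable.of_discrete.aemeasurable
  have hmean : ∫ ω, (∑ j, Y j) ω ∂P = ∑ j, ∫ ω, Y j ω ∂P := by
    simp only [Finset.sum_apply]
    exact integral_finsetSum _ fun j _ => hYint j
  have hvar : Var[∑ j, Y j; P] ≤ 2 * R ^ 2 := by
    rw [IndepFun.variance_sum (fun j _ => hYmem j)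
      fun i _ j _ hij => hind.indepFun hij]
    have h1 : ∀ j, Var[Y j; P] ≤ 2 * R * itemRevenue c (μ j) := fun j => by
      refine (variance_le_expectation_sq
        StronglyMeasurable.of_discrete.aestronglyMeasurable).trans ?_
      refine le_trans (le_of_eq ?_) (integral_sq_le (μ j) hc hR0 (hA j))
      have h2 := integral_map (μ := P) (measurable_pi_apply j).aemeasurable
        (f := fun a : A j => coreValue c R a ^ 2)
        StronglyMeasurable.of_discrete.aestronglyMeasurable
      rw [(measurePreserving_eval μ j).map_eq] at h2
      exact h2.symm
    calc _ ≤ ∑ j, 2 * R * itemRevenue c (μ j) := Finset.sum_le_sum fun j _ => h1 j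
      _ = 2 * R ^ 2 := by rw [← Finset.mul_sum, ← hR]; ring
  set C := ∑ j, ∫ ω, Y j ω ∂P with hC
  have hsum : MemLp (∑ j, Y j) 2 P := memLp_finsetSum' _ fun j _ => hYmem j
  have hcheb : P.real {ω | 2 * R ≤ |(∑ j, Y j) ω - C|} ≤ 1 / 2 := by
    have h1 := meas_ge_le_variance_div_sq hsum (c := 2 * R) (by linarith)
    rw [hmean] at h1
    refine ENNReal.toReal_le_of_le_ofReal (by norm_num)
      (h1.trans (ENNReal.ofReal_le_ofReal ?_))
    rw [div_le_iff₀ (by positivity)]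
    linarith
  have hhalf : ∀ q, q ≤ C - 2 * R → 1 / 2 ≤ P.real {ω | q ≤ ∑ j, (ω j : ℝ)} := fun q hq => by
    have h1 : P.real {ω | 2 * R ≤ |(∑ j, Y j) ω - C|}ᶜ ≤ P.real {ω | q ≤ ∑ j, (ω j : ℝ)} := by
      refine measureReal_mono fun ω hω => ?_
      simp only [Set.mem_compl_iff, Set.mem_ofPred_eq, not_le, abs_lt, Finset.sum_apply] at hω
      have h2 : ∑ j, Y j ω ≤ ∑ j, (ω j : ℝ) :=
        Finset.sum_le_sum fun j _ => coreValue_le_self (hA j _ (ω j).2)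
      simp only [Set.mem_ofPred_eq]
      linarith [hω.1]
    rw [probReal_compl_eq_one_sub .of_discrete] at h1
    linarith
  rcases le_or_gt (C - 2 * R) 0 with h | h
  · linarith
  rcases le_or_gt (C - 2 * R) b with hb | hb
  · nlinarith [hB _ h.le hb, hhalf _ le_rfl]
  · nlinarith [hB b (by linarith) le_rfl, hhalf b hb.le]

/-! ### The revenue of a truthful mechanism -/

/-- The payment is charged to the favorite item and to the values of the other items, except when
some item alone is worth `c`; there only the budget bounds the payment. -/
theorem integral_payment_le {m : ℕ} [Nonempty (Fin m)] {A : Fin m → Set ℝ} [∀ j, Countable (A j)]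
    (μ : ∀ j, Measure (A j)) [∀ j, IsProbabilityMeasure (μ j)] (hA : ∀ j, ∀ a ∈ A j, 0 ≤ a)
    {b c R B : ℝ} (hc : 0 ≤ c) (hR : R = ∑ j, itemRevenue c (μ j)) (hB0 : 0 ≤ B)
    (hBb : 2 * B < b)
    (hB : ∀ q, 0 ≤ q → q ≤ b → q * (Measure.pi μ).real {ω | q ≤ ∑ j, (ω j : ℝ)} ≤ B)
    {x : (∀ j, A j) → Fin m → ℝ} {p : (∀ j, A j) → ℝ}
    (hx : ∀ ω j, 0 ≤ x ω j ∧ x ω j ≤ 1)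
    (hic : ∀ ω ω', ∑ j, x ω' j * (ω j : ℝ) - p ω' ≤ ∑ j, x ω j * (ω j : ℝ) - p ω)
    (hir : ∀ ω, 0 ≤ ∑ j, x ω j * (ω j : ℝ) - p ω) (hpb : ∀ ω, p ω ≤ b)
    (hp : Integrable p (Measure.pi μ)) :
    ∫ ω, p ω ∂Measure.pi μ
      ≤ b * (Measure.pi μ).real {ω | c ≤ ∑ j, (ω j : ℝ)} + 4 * R + 2 * B := by
  have hnn : ∀ (ω : ∀ j, A j) j, 0 ≤ (ω j : ℝ) := fun ω j => hA j _ (ω j).2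
  have hb0 : 0 ≤ b := by linarith
  set P := Measure.pi μ
  choose fav hfav using fun ω : ∀ j, A j => Finite.exists_max fun j => (ω j : ℝ)
  let E : Fin m → Set (∀ j, A j) := fun j => {ω | fav ω = j ∧ ∀ k, (ω k : ℝ) < c}
  let pay : Fin m → (∀ j, A j) → ℝ := fun j =>
    (E j).indicator fun ω => p ω - ∑ k ∈ Finset.univ.erase j, x ω k * (ω k : ℝ)
  let T : Fin m → Fin m → (∀ j, A j) → ℝ := fun j k ω =>
    if (R < ω j ∧ (ω j : ℝ) < c) ∧ (ω j : ℝ) ≤ ω k then (ω j : ℝ) else 0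
  let H : Set (∀ j, A j) := {ω | c ≤ ∑ j, (ω j : ℝ)}
  have hT0 : ∀ j k ω, 0 ≤ T j k ω := fun j k ω => by
    dsimp only [T]
    split_ifs
    exacts [hnn ω j, le_rfl]
  have hTint : ∀ j k, Integrable (T j k) P := fun j k => integrable_of_abs_le (C := c) fun ω => by
    rw [abs_of_nonneg (hT0 j k ω)]
    dsimp only [T]
    split_ifs with h
    exacts [h.1.2.le, hc]
  have hYint : ∀ j, Integrable (fun ω : ∀ j, A j => coreValue c R (ω j)) P := fun j =>
    integrable_of_abs_le (C := c) fun ω => abs_coreValue_le hc (hnn ω j)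
  have hpayint : ∀ j, Integrable (pay j) P := fun j => by
    have h1 : pay j = fun ω => (E j).indicator p ω
        - (E j).indicator (fun ω => ∑ k ∈ Finset.univ.erase j, x ω k * (ω k : ℝ)) ω := by
      funext ω
      by_cases h : ω ∈ E j <;> simp [pay, h]
    rw [h1]
    refine (hp.indicator .of_discrete).sub (integrable_of_abs_le (C := m * c) fun ω => ?_)
    by_cases h : ω ∈ E j
    · have h3 : ∀ k, 0 ≤ x ω k * (ω k : ℝ) := fun k => mul_nonneg (hx ω k).1 (hnn ω k)
      rw [Set.indicator_of_mem h, abs_of_nonneg (Finset.sum_nonneg fun k _ => h3 k)]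
      calc _ ≤ ∑ k, x ω k * (ω k : ℝ) :=
            Finset.sum_le_sum_of_subset_of_nonneg (Finset.erase_subset _ _) fun k _ _ => h3 k
        _ ≤ ∑ _k : Fin m, c := Finset.sum_le_sum fun k _ =>
            (mul_le_of_le_one_left (hnn ω k) (hx ω k).2).trans (h.2 k).le
        _ = m * c := by simp
    · rw [Set.indicator_of_notMem h, abs_zero]
      positivity
  -- the charging scheme, pointwise
  have hpt : ∀ ω, p ω ≤ H.indicator (fun _ => b) ω + ∑ j, pay j ω
      + ∑ j, ∑ k ∈ Finset.univ.erase j, T j k ω + ∑ j, coreValue c R (ω j) := fun ω => by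
    have hT : 0 ≤ ∑ j, ∑ k ∈ Finset.univ.erase j, T j k ω :=
      Finset.sum_nonneg fun j _ => Finset.sum_nonneg fun k _ => hT0 j k ω
    have hY : 0 ≤ ∑ j, coreValue c R (ω j) :=
      Finset.sum_nonneg fun j _ => coreValue_nonneg (hnn ω j)
    by_cases hω : ∀ k, (ω k : ℝ) < c
    · have h1 : ∑ j, pay j ω = p ω - ∑ k ∈ Finset.univ.erase (fav ω), x ω k * (ω k : ℝ) := by
        rw [Finset.sum_eq_single (fav ω)]
        · exact Set.indicator_of_mem (show ω ∈ E (fav ω) from ⟨rfl, hω⟩) _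
        · intro j _ hj
          exact Set.indicator_of_notMem (fun h : ω ∈ E j => hj h.1.symm) _
        · simp
      have h2 : ∑ k ∈ Finset.univ.erase (fav ω), x ω k * (ω k : ℝ)
          ≤ ∑ k, ∑ l ∈ Finset.univ.erase k, T k l ω + ∑ k, coreValue c R (ω k) := by
        rw [← Finset.sum_add_distrib]
        calc _ ≤ ∑ k ∈ Finset.univ.erase (fav ω),
              (∑ l ∈ Finset.univ.erase k, T k l ω + coreValue c R (ω k)) := by
              refine Finset.sum_le_sum fun k hk => ?_
              refine (mul_le_of_le_one_left (hnn ω k) (hx ω k).2).trans ?_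
              rcases le_or_gt (ω k : ℝ) R with hkR | hkR
              · have h3 : coreValue c R (ω k) = ω k := if_pos ⟨hkR, hω k⟩
                rw [h3]
                exact le_add_of_nonneg_left (Finset.sum_nonneg fun l _ => hT0 k l ω)
              · have h3 : T k (fav ω) ω = ω k := if_pos ⟨⟨hkR, hω k⟩, hfav ω k⟩
                have h4 : T k (fav ω) ω ≤ ∑ l ∈ Finset.univ.erase k, T k l ω :=
                  Finset.single_le_sum (f := fun l => T k l ω) (fun l _ => hT0 k l ω)
                    (by simpa using (Finset.ne_of_mem_erase hk).symm)
                linarith [coreValue_nonneg (c := c) (τ := R) (hnn ω k)]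
          _ ≤ _ := Finset.sum_le_sum_of_subset_of_nonneg (Finset.erase_subset _ _) fun k _ _ =>
              add_nonneg (Finset.sum_nonneg fun l _ => hT0 k l ω) (coreValue_nonneg (hnn ω k))
      have h3 : 0 ≤ H.indicator (fun _ => b) ω := Set.indicator_nonneg (fun _ _ => hb0) _
      linarith
    · have h1 : ∑ j, pay j ω = 0 := Finset.sum_eq_zero fun j _ =>
        Set.indicator_of_notMem (fun h : ω ∈ E j => hω h.2) _
      push Not at hω
      obtain ⟨k, hk⟩ := hω
      have h2 : ω ∈ H :=
        hk.trans (Finset.single_le_sum (fun j _ => hnn ω j) (Finset.mem_univ k))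
      rw [Set.indicator_of_mem h2, h1]
      linarith [hpb ω]
  have hi1 : Integrable (H.indicator fun _ => b) P := (integrable_const b).indicator .of_discrete
  have hi2 : Integrable (fun ω => ∑ j, pay j ω) P := integrable_finsetSum _ fun j _ => hpayint j
  have hi3 : Integrable (fun ω => ∑ j, ∑ k ∈ Finset.univ.erase j, T j k ω) P :=
    integrable_finsetSum _ fun j _ => integrable_finsetSum _ fun k _ => hTint j k
  have hi4 : Integrable (fun ω : ∀ j, A j => ∑ j, coreValue c R (ω j)) P :=
    integrable_finsetSum _ fun j _ => hYint j
  have hmono := integral_mono hp (((hi1.add hi2).add hi3).add hi4) hpt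
  rw [integral_add' ((hi1.add hi2).add hi3) hi4, integral_add' (hi1.add hi2) hi3,
    integral_add' hi1 hi2, integral_indicator_const _ .of_discrete, smul_eq_mul, mul_comm,
    integral_finsetSum _ fun j _ => hpayint j,
    integral_finsetSum _ fun j _ => integrable_finsetSum _ fun k _ => hTint j k,
    integral_finsetSum _ fun j _ => hYint j] at hmono
  have hpay : ∑ j, ∫ ω, pay j ω ∂P ≤ R := by
    rw [hR]
    exact Finset.sum_le_sum fun j _ =>
      integral_excessPayment_le μ hA hc hx hic hir j (E j) (fun ω h => h.2 j) (hpayint j)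
  have htail : ∑ j, ∫ ω, ∑ k ∈ Finset.univ.erase j, T j k ω ∂P ≤ R := by
    refine le_trans (le_of_eq ?_) (integral_tail_sum_le μ hA hc hR)
    exact Finset.sum_congr rfl fun j _ => integral_finsetSum _ fun k _ => hTint j k
  have hcore := integral_core_le μ hA hc hR hB0 hBb hB
  linarith

/-! ### The revenue of posted item prices -/

/-- The event that item `j` is worth its price is independent of the event that the other items are
worth less than `c`, and the latter contains the event that all items together are. -/
theorem sum_posted_le_integral {m : ℕ} {A : Fin m → Set ℝ} [∀ j, Countable (A j)]
    (μ : ∀ j, Measure (A j)) [∀ j, IsProbabilityMeasure (μ j)] (hA : ∀ j, ∀ a ∈ A j, 0 ≤ a)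
    {c : ℝ} {q : Fin m → ℝ} (hq : ∀ j, 0 ≤ q j) :
    (1 - (Measure.pi μ).real {ω | c ≤ ∑ j, (ω j : ℝ)})
        * ∑ j, q j * (μ j).real {a | q j ≤ (a : ℝ)}
      ≤ ∫ ω : ∀ j, A j, ∑ j, (if q j ≤ ω j ∧ ∑ k ∈ Finset.univ.erase j, (ω k : ℝ) < c
          then q j else 0) ∂Measure.pi μ := by
  set P := Measure.pi μ
  have hint : ∀ j, Integrable (fun ω : ∀ j, A j =>
      if q j ≤ ω j ∧ ∑ k ∈ Finset.univ.erase j, (ω k : ℝ) < c then q j else 0) P := fun j =>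
    integrable_of_abs_le (C := q j) fun ω => by
      split_ifs
      · exact (abs_of_nonneg (hq j)).le
      · simpa using hq j
  rw [integral_finsetSum _ fun j _ => hint j, Finset.mul_sum]
  refine Finset.sum_le_sum fun j _ => ?_
  have hcond : ∀ ω : ∀ j, A j, ∫ a, (if q j ≤ Function.update ω j a j
        ∧ ∑ k ∈ Finset.univ.erase j, (Function.update ω j a k : ℝ) < c then q j else 0) ∂μ j
      = {ω : ∀ j, A j | ∑ k ∈ Finset.univ.erase j, (ω k : ℝ) < c}.indicator
          (fun _ => q j * (μ j).real {a | q j ≤ (a : ℝ)}) ω := fun ω => by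
    have h1 : ∀ a : A j, ∑ k ∈ Finset.univ.erase j, (Function.update ω j a k : ℝ)
        = ∑ k ∈ Finset.univ.erase j, (ω k : ℝ) := fun a =>
      Finset.sum_congr rfl fun k hk => by rw [Function.update_of_ne (Finset.ne_of_mem_erase hk)]
    simp only [h1, Function.update_self]
    by_cases h : ∑ k ∈ Finset.univ.erase j, (ω k : ℝ) < c
    · rw [Set.indicator_of_mem (by exact h)]
      have h2 : ∀ a : A j, (if q j ≤ (a : ℝ) ∧ ∑ k ∈ Finset.univ.erase j, (ω k : ℝ) < c
          then q j else 0) = {a : A j | q j ≤ (a : ℝ)}.indicator (fun _ => q j) a := fun a => by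
        by_cases ha : q j ≤ (a : ℝ) <;> simp only [h, ha, and_self, and_true, if_true, if_false,
            Set.indicator, Set.mem_ofPred_eq]
      simp_rw [h2]
      rw [integral_indicator_const _ .of_discrete, smul_eq_mul, mul_comm]
    · rw [Set.indicator_of_notMem (by exact h)]
      simp only [h, and_false, if_false, integral_zero]
  rw [integral_update μ j (hint j)]
  simp_rw [hcond]
  rw [integral_indicator_const _ .of_discrete, smul_eq_mul]
  refine mul_le_mul_of_nonneg_right ?_ (mul_nonneg (hq j) measureReal_nonneg)
  rw [← probReal_compl_eq_one_sub .of_discrete]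
  refine measureReal_mono fun ω hω => ?_
  simp only [Set.mem_compl_iff, Set.mem_ofPred_eq, not_le] at hω
  exact lt_of_le_of_lt (Finset.sum_le_sum_of_subset_of_nonneg (Finset.erase_subset _ _)
    fun k _ _ => hA k _ (ω k).2) hω

/-! ### From probability mass functions to product measures -/

/-- A distribution with probability mass function `D`, as a distribution on its support. -/
noncomputable def supportPMF (D : PMF ℝ) : PMF D.support :=
  ⟨fun a => D a, (hasSum_subtype_iff_of_support_subset subset_rfl).2 D.2⟩

instance countable_support (D : PMF ℝ) : Countable D.support := D.support_countable.to_subtype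

/-- The joint distribution of independent values, on the product of the supports. -/
noncomputable def productMeasure {m : ℕ} (D : Fin m → PMF ℝ) : Measure (∀ j, (D j).support) :=
  Measure.pi fun j => (supportPMF (D j)).toMeasure

/-- The type of the buyer at an outcome of the product space. -/
def typeOf {m : ℕ} {A : Fin m → Set ℝ} (ω : ∀ j, A j) : BuyerType m := fun j => ω j

theorem mem_support_typeOf {m : ℕ} {V : PMF (BuyerType m)} {D : Fin m → PMF ℝ}
    (hV : ∀ t, V t = ∏ j, D j (t j)) (ω : ∀ j, (D j).support) : typeOf ω ∈ V.support := by
  rw [PMF.mem_support_iff, hV]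
  exact Finset.prod_ne_zero_iff.2 fun j _ => (ω j).2

theorem productMeasure_singleton {m : ℕ} {V : PMF (BuyerType m)} {D : Fin m → PMF ℝ}
    (hV : ∀ t, V t = ∏ j, D j (t j)) (ω : ∀ j, (D j).support) :
    productMeasure D {ω} = V (typeOf ω) := by
  rw [productMeasure, Measure.pi_singleton, hV]
  refine Finset.prod_congr rfl fun j _ => ?_
  rw [PMF.toMeasure_apply_singleton _ _ (measurableSet_singleton _)]
  rfl

theorem IsExpectedRevenue.integral_eq {m : ℕ} {V : PMF (BuyerType m)} {D : Fin m → PMF ℝ}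
    (hV : ∀ t, V t = ∏ j, D j (t j)) {pay : BuyerType m → ℝ} {R : ℝ}
    (h : IsExpectedRevenue V pay R) :
    Integrable (fun ω => pay (typeOf ω)) (productMeasure D) ∧
      ∫ ω, pay (typeOf ω) ∂productMeasure D = R := by
  have hinj : Function.Injective fun ω : ∀ j, (D j).support => typeOf ω := fun ω ω' hω =>
    funext fun j => Subtype.ext (congrFun hω j)
  have h1 : HasSum (fun ω : ∀ j, (D j).support => (V (typeOf ω)).toReal * pay (typeOf ω)) R := by
    refine (hinj.hasSum_iff (f := fun t => (V t).toReal * pay t) fun t ht => ?_).2 h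
    have h2 : V t = 0 := by
      by_contra h3
      rw [hV] at h3
      exact ht ⟨fun j => ⟨t j, Finset.prod_ne_zero_iff.1 h3 j (Finset.mem_univ j)⟩, rfl⟩
    simp [h2]
  have hP : Measure.sum (fun ω => V (typeOf ω) • Measure.dirac ω) = productMeasure D := by
    simp_rw [← productMeasure_singleton hV]
    exact Measure.sum_smul_dirac _
  have h2 : Integrable (fun ω => pay (typeOf ω)) (productMeasure D) := by
    rw [← hP]
    refine integrable_sum_dirac (fun ω => V.apply_ne_top _) ?_
    simpa [abs_mul] using h1.summable.abs
  refine ⟨h2, ?_⟩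
  rw [← hP] at h2 ⊢
  have h3 := hasSum_integral_measure h2
  simp only [integral_smul_measure, integral_dirac, smul_eq_mul] at h3
  exact h3.unique h1

/-! ### Lower bounds on the simple mechanisms -/

theorem bundle_le_BRev {m : ℕ} {b : ℝ} {V : PMF (BuyerType m)} {D : Fin m → PMF ℝ}
    (hV : ∀ t, V t = ∏ j, D j (t j)) {q : ℝ} (hq : 0 ≤ q) (hqb : q ≤ b) :
    q * (productMeasure D).real {ω | q ≤ ∑ j, (ω j : ℝ)} ≤ BRev b V := by
  obtain ⟨R, hR⟩ := exists_isExpectedRevenue V (bundlePayment b q) q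
    (fun t => by unfold bundlePayment; split_ifs <;> simp [hq])
    (fun t => by unfold bundlePayment; split_ifs <;> simp [hq])
  refine le_trans (le_of_eq ?_)
    (le_csSup (bundleRevenues_bddAbove (hq.trans hqb) V) ⟨q, hq, hR⟩)
  rw [← (hR.integral_eq hV).2]
  have h1 : ∀ ω : ∀ j, (D j).support, bundlePayment b q (typeOf ω)
      = {ω : ∀ j, (D j).support | q ≤ ∑ j, (ω j : ℝ)}.indicator (fun _ => q) ω := fun ω => by
    by_cases h : q ≤ ∑ j, (ω j : ℝ) <;> simp [bundlePayment, typeOf, hqb, h]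
  simp_rw [h1]
  rw [integral_indicator_const _ .of_discrete, smul_eq_mul, mul_comm]

/-- If the buyer can afford all items worth their price, then he buys them. -/
theorem isDemanded_filter {m : ℕ} {b : ℝ} {q : Fin m → ℝ} {t : BuyerType m}
    (h : ∑ j with q j ≤ t j, q j ≤ b) : IsDemanded b q t ({j | q j ≤ t j} : Finset (Fin m)) := by
  refine ⟨h, fun S' _ => ?_⟩
  calc ∑ j ∈ S', (t j - q j) ≤ ∑ j ∈ S', (if q j ≤ t j then t j - q j else 0) :=
        Finset.sum_le_sum fun j _ => by split_ifs <;> linarith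
    _ ≤ ∑ j, (if q j ≤ t j then t j - q j else 0) :=
        Finset.sum_le_sum_of_subset_of_nonneg (Finset.subset_univ _)
          fun j _ _ => by split_ifs <;> linarith
    _ = _ := (Finset.sum_filter _ _).symm

/-- At item prices of at most `b / 2`, the budget does not keep the buyer from item `j` unless the
other items are worth `b / 2`, which has a small probability if the bundle revenue is small. -/
theorem posted_le_SRev {m : ℕ} {b : ℝ} (hb : 0 ≤ b) {V : PMF (BuyerType m)} {D : Fin m → PMF ℝ}
    (hV : ∀ t, V t = ∏ j, D j (t j)) (hA : ∀ j, ∀ a ∈ (D j).support, 0 ≤ a) {q : Fin m → ℝ}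
    (hq : ∀ j, 0 ≤ q j) (hqb : ∀ j, q j ≤ b / 2) :
    (1 - (productMeasure D).real {ω | b / 2 ≤ ∑ j, (ω j : ℝ)})
        * ∑ j, q j * (supportPMF (D j)).toMeasure.real {a | q j ≤ (a : ℝ)} ≤ SRev b V := by
  classical
  obtain ⟨S₀, -, hS₀, -⟩ := exists_separateRevenue hb V q hq
  set S : BuyerType m → Finset (Fin m) := fun t =>
    if ∑ j with q j ≤ t j, q j ≤ b then ({j | q j ≤ t j} : Finset (Fin m)) else S₀ t with hSdef
  have hS : ∀ t, IsDemanded b q t (S t) := fun t => by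
    by_cases h : ∑ j with q j ≤ t j, q j ≤ b
    · simpa only [hSdef, if_pos h] using isDemanded_filter h
    · simpa only [hSdef, if_neg h] using hS₀ t
  obtain ⟨R, hR⟩ := exists_isExpectedRevenue V (fun t => ∑ j ∈ S t, q j) b
    (fun t => Finset.sum_nonneg fun j _ => hq j) (fun t => (hS t).1)
  obtain ⟨hint, heq⟩ := hR.integral_eq hV
  refine le_trans ?_ (le_csSup (separateRevenues_bddAbove b V) ⟨q, S, hq, fun t _ => hS t, hR⟩)
  refine (sum_posted_le_integral (fun j => (supportPMF (D j)).toMeasure) hA (c := b / 2) hq).trans ?_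
  rw [← heq]
  refine integral_mono_of_nonneg (Filter.Eventually.of_forall fun ω =>
    Finset.sum_nonneg fun j _ => by split_ifs <;> simp [hq j]) hint
    (Filter.Eventually.of_forall fun ω => ?_)
  by_cases h : ∑ j with q j ≤ typeOf ω j, q j ≤ b
  · simp only [hSdef, if_pos h]
    rw [Finset.sum_filter]
    refine Finset.sum_le_sum fun j _ => ?_
    by_cases hj : q j ≤ typeOf ω j
    · rw [if_pos hj]
      split_ifs <;> simp [hq j]
    · rw [if_neg hj, if_neg fun h' => hj h'.1]
  · refine le_trans (le_of_eq ?_) (Finset.sum_nonneg fun j _ => hq j)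
    refine Finset.sum_eq_zero fun j _ => if_neg fun h' => h ?_
    -- the items worth their price cost at most `q j` plus the value of the other items
    rw [Finset.sum_filter, ← Finset.add_sum_erase _ _ (Finset.mem_univ j)]
    have h1 : ∑ k ∈ Finset.univ.erase j, (if q k ≤ typeOf ω k then q k else 0)
        ≤ ∑ k ∈ Finset.univ.erase j, (ω k : ℝ) := Finset.sum_le_sum fun k _ => by
      split_ifs with hk
      exacts [hk, hA k _ (ω k).2]
    have h2 : (if q j ≤ typeOf ω j then q j else 0) ≤ b / 2 := by
      split_ifs
      exacts [hqb j, by linarith]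
    linarith [h'.2]

theorem itemRevenue_sum_le_SRev {m : ℕ} {b : ℝ} (hb : 0 ≤ b) {V : PMF (BuyerType m)}
    {D : Fin m → PMF ℝ} (hV : ∀ t, V t = ∏ j, D j (t j))
    (hA : ∀ j, ∀ a ∈ (D j).support, 0 ≤ a) {π : ℝ}
    (hπ : π = (productMeasure D).real {ω | b / 2 ≤ ∑ j, (ω j : ℝ)}) (hπ1 : π ≤ 1) :
    (1 - π) * ∑ j, itemRevenue (b / 2) (supportPMF (D j)).toMeasure ≤ SRev b V := by
  refine le_of_forall_pos_le_add fun ε hε => ?_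
  have hm : 0 < (m : ℝ) + 1 := by positivity
  choose q hq0 hqb hq using fun j =>
    exists_price_near_itemRevenue (by linarith : 0 ≤ b / 2) (supportPMF (D j)).toMeasure
      (div_pos hε hm)
  have h1 := posted_le_SRev hb hV hA hq0 hqb
  rw [← hπ] at h1
  have h2 : ∑ j, itemRevenue (b / 2) (supportPMF (D j)).toMeasure - ε
      ≤ ∑ j, q j * (supportPMF (D j)).toMeasure.real {a | q j ≤ (a : ℝ)} := by
    have h3 := Finset.sum_le_sum fun j (_ : j ∈ Finset.univ) => hq j
    rw [Finset.sum_sub_distrib] at h3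
    have h4 : ∑ _j : Fin m, ε / ((m : ℝ) + 1) ≤ ε := by
      rw [Finset.sum_const, Finset.card_univ, Fintype.card_fin, nsmul_eq_mul, ← mul_div_assoc,
        div_le_iff₀ hm]
      linarith
    linarith
  have h5 := mul_le_mul_of_nonneg_left h2 (sub_nonneg.2 hπ1)
  have h6 : 0 ≤ π := hπ ▸ measureReal_nonneg
  nlinarith

theorem SRev_nonneg {m : ℕ} {b : ℝ} (hb : 0 ≤ b) (V : PMF (BuyerType m)) : 0 ≤ SRev b V := by
  obtain ⟨S, R, hS, hR⟩ := exists_separateRevenue hb V 0 (fun _ => le_rfl)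
  have h0 : R = 0 := hR.unique (by simp [hasSum_zero])
  exact le_csSup (separateRevenues_bddAbove b V) ⟨0, S, fun _ => le_rfl, fun t _ => hS t, h0 ▸ hR⟩

theorem BRev_nonneg {m : ℕ} {b : ℝ} (hb : 0 ≤ b) (V : PMF (BuyerType m)) : 0 ≤ BRev b V :=
  le_csSup (bundleRevenues_bddAbove hb V)
    ⟨0, le_rfl, by simp [IsExpectedRevenue, bundlePayment, hasSum_zero]⟩

/-! ### The approximation guarantee -/

theorem IsTruthful.revenue_le {m : ℕ} {b : ℝ} (hb : 0 ≤ b) {V : PMF (BuyerType m)}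
    (hnonneg : ∀ t ∈ V.support, ∀ j, 0 ≤ t j) (hindep : IndependentAcrossItems V)
    {x : BuyerType m → Fin m → ℝ} {p : BuyerType m → ℝ} (hM : IsTruthful b V x p) {R₀ : ℝ}
    (hR₀ : IsExpectedRevenue V p R₀) : R₀ ≤ 5 * SRev b V + 6 * BRev b V := by
  have hS0 := SRev_nonneg hb V
  have hB0 := BRev_nonneg hb V
  rcases isEmpty_or_nonempty (Fin m) with hm | hm
  · have h0 : R₀ ≤ 0 := hR₀.le fun t ht => by simpa using hM.ir t ht
    linarith
  rcases le_or_gt b (5 * SRev b V + 6 * BRev b V) with hbig | hsmall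
  · exact (hR₀.le hM.budget).trans hbig
  obtain ⟨D, hV⟩ := hindep
  have hA : ∀ j, ∀ a ∈ (D j).support, 0 ≤ a := fun j a ha => by
    classical
    choose d hd using fun k => (D k).support_nonempty
    have h1 := mem_support_typeOf hV (Function.update (fun k => ⟨d k, hd k⟩) j ⟨a, ha⟩)
    simpa [typeOf] using hnonneg _ h1 j
  have hB : ∀ q, 0 ≤ q → q ≤ b →
      q * (productMeasure D).real {ω | q ≤ ∑ j, (ω j : ℝ)} ≤ BRev b V :=
    fun q h0 h1 => bundle_le_BRev hV h0 h1
  have hmem := mem_support_typeOf hV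
  obtain ⟨hint, heq⟩ := hR₀.integral_eq hV
  have hb2 : 0 ≤ b / 2 := by linarith
  have hup := integral_payment_le (fun j => (supportPMF (D j)).toMeasure) hA hb2 rfl hB0
    (by linarith) hB (x := fun ω => x (typeOf ω)) (p := fun ω => p (typeOf ω))
    (fun ω j => hM.alloc _ (hmem ω) j) (fun ω ω' => hM.ic _ (hmem ω) _ (hmem ω'))
    (fun ω => hM.ir _ (hmem ω)) (fun ω => hM.budget _ (hmem ω)) hint
  change ∫ ω, p (typeOf ω) ∂productMeasure D
    ≤ b * (productMeasure D).real {ω | b / 2 ≤ ∑ j, (ω j : ℝ)} + _ + _ at hup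
  rw [heq] at hup
  set π := (productMeasure D).real {ω | b / 2 ≤ ∑ j, (ω j : ℝ)} with hπ
  have hπB := hB (b / 2) hb2 (by linarith)
  rw [← hπ] at hπB
  have hbpos : 0 < b := by linarith
  have hπ3 : π ≤ 1 / 3 := by nlinarith
  have hlow := itemRevenue_sum_le_SRev hb hV hA hπ (by linarith)
  set R := ∑ j, itemRevenue (b / 2) (supportPMF (D j)).toMeasure
  have hR0 : 0 ≤ R := Finset.sum_nonneg fun j _ => itemRevenue_nonneg hb2 _
  have h4R : 4 * R ≤ 5 * SRev b V + 2 * BRev b V := by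
    rcases le_or_gt π (1 / 5) with h | h
    · nlinarith
    · -- here `BRev` exceeds `b / 10`, which leaves at most `2 * b / 25` for `SRev`
      have h1 : b / 10 ≤ BRev b V := by nlinarith
      nlinarith
  linarith

theorem Rev_le {m : ℕ} {b : ℝ} (hb : 0 ≤ b) {V : PMF (BuyerType m)}
    (hnonneg : ∀ t ∈ V.support, ∀ j, 0 ≤ t j) (hindep : IndependentAcrossItems V) :
    Rev b V ≤ 5 * SRev b V + 6 * BRev b V := by
  refine csSup_le (truthfulRevenues_nonempty hb V) ?_
  rintro R₀ ⟨x, p, hM, hR₀⟩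
  exact hM.revenue_le hb hnonneg hindep hR₀

end BudgetAuction

theorem theorem1 (m : ℕ) (b : ℝ) (hb : 0 ≤ b) (V : PMF (BuyerType m))
    (hnonneg : ∀ t ∈ V.support, ∀ j, 0 ≤ t j)
    (hindep : BudgetAuction.IndependentAcrossItems V) :
    BudgetAuction.Rev b V ≤ 8 * BudgetAuction.SRev b V + 24 * BudgetAuction.BRev b V ∧
      BudgetAuction.Rev b V ≤ 5 * BudgetAuction.SRev b V + 6 * BudgetAuction.BRev b V ∧
      BudgetAuction.Rev b V ≤ 11 * max (BudgetAuction.SRev b V) (BudgetAuction.BRev b V) := by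
  have h := BudgetAuction.Rev_le hb hnonneg hindep
  have hS := BudgetAuction.SRev_nonneg hb V
  have hB := BudgetAuction.BRev_nonneg hb V
  refine ⟨by linarith, h, ?_⟩
  have h1 := le_max_left (BudgetAuction.SRev b V) (BudgetAuction.BRev b V)
  have h2 := le_max_right (BudgetAuction.SRev b V) (BudgetAuction.BRev b V)
  linarith
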